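/- Let $d\in\mathbb N$, let $\mathbb Z_-=\{\dots,-2,-1,0\}$, let $p\in[1,\infty]$ with Hölder conjugate $q$, and let $\ell^p,\ell^q$ be the usual spaces of real sequences indexed by $\mathbb N$; for $\mathbf a\in\ell^p$, $\mathbf x\in\ell^q$ write $\mathbf a\cdot\mathbf x=\sum_i a_ix_i$. For $D_d\subset\mathbb R^d$ let $\ell^\infty_-(D_d)$ be the set of sequences $\mathbf z=(\mathbf z_t)_{t\in\mathbb Z_-}$ with all $\mathbf z_t\in D_d$ and $\sup_t\|\mathbf z_t\|<\infty$, and let $\mathcal I_d\subset\ell^\infty_-(D_d)$, equipped with the trace of the product $\sigma$-algebra of $(\mathbb R^d)^{\mathbb Z_-}$. Let $\sigma_1,\sigma_2\colon\mathbb R\to\mathbb R$. Let $\mathcal C$ be the class of recurrent (generalized) Barron functionals, that is, of all $H\colon\mathcal I_d\to\mathbb R$ for which there exist a Borel probability measure $\mu$ on $\mathcal X=\mathbb R\times\ell^p\times\mathbb R^d\times\mathbb R$, some $\mathbf B\in\ell^q$ and linear maps $A\colon\ell^q\to\ell^q$, $C\colon\mathbb R^d\to\ell^q$ such that (i) for each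 $\mathbf z\in\mathcal I_d$ the system $$\mathbf x_t=\sigma_1(A\mathbf x_{t-1}+C\mathbf z_t+\mathbf B),\qquad t\in\mathbb Z_-,$$ with $\sigma_1$ applied componentwise, has a unique solution $(\mathbf x_t(\mathbf z))_{t\in\mathbb Z_-}$ in $(\ell^q)^{\mathbb Z_-}$ with $\sup_t\|\mathbf x_t(\mathbf z)\|_q<\infty$; (ii) $\int_{\mathcal X}|w|(\|\mathbf a\|_p+\|\mathbf c\|+|b|)\,\mu(dw,d\mathbf a,d\mathbf c,db)<\infty$; and (iii) for each $\mathbf z\in\mathcal I_d$, $$H(\mathbf z)=\int_{\mathcal X}w\,\sigma_2(\mathbf a\cdot\mathbf x_{-1}(\mathbf z)+\mathbf c\cdot\mathbf z_0+b)\,\mu(dw,d\mathbf a,d\mathbf c,db),$$ where the integrand is $\mu$-integrable. Assume that $\sigma_1(x)=x$ for all $x$, and that either $\sigma_2(x)=\max(x,0)$ for all $x$, or $\sigma_2$ is bounded, continuous and non-constant. Let $\bar p\in[1,\infty)$ and let $\gamma$ be a probability measure on $\mathcal I_d$. Then $\mathcal C\cap L^{\bar p}(\mathcal I_d,\gamma)$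 is dense in $L^{\bar p}(\mathcal I_d,\gamma)$. -/

import Mathlib

open MeasureTheory
open scoped ENNReal

noncomputable section

namespace RecurrentBarron

/-- The non-positive integers `ℤ₋ = {…, -2, -1, 0}`. -/
abbrev ZMinus : Type := {t : ℤ // t ≤ 0}

/-- The time `0`. -/
def ZMinus.zero : ZMinus := ⟨0, le_refl 0⟩

/-- The predecessor `t - 1` of a time `t ∈ ℤ₋`. -/
def ZMinus.pred (t : ZMinus) : ZMinus := ⟨t.1 - 1, by have := t.2; omega⟩

/-- The real sequence space `ℓ^r`, indexed by `ℕ`. -/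
abbrev SeqSpace (r : ℝ≥0∞) : Type := lp (fun _ : ℕ => ℝ) r

/-- Input sequences `(ℝ^d)^{ℤ₋}`, with the product `σ`-algebra. -/
abbrev InputSeq (d : ℕ) : Type := ZMinus → EuclideanSpace ℝ (Fin d)

/-- `ℓ^∞₋(D)`: the sequences `z ∈ D^{ℤ₋}` with `sup_t ‖z_t‖ < ∞`. -/
def boundedInputs {d : ℕ} (D : Set (EuclideanSpace ℝ (Fin d))) : Set (InputSeq d) :=
  {z | (∀ t, z t ∈ D) ∧ BddAbove (Set.range fun t => ‖z t‖)}

/-- The parameter space `ℝ × ℓ^p × ℝ^d × ℝ` of tuples `(w, a, c, b)`. It is a `def` so that it can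
carry the Borel `σ`-algebra of the product topology, which for `p = ∞` need not agree with the
product `σ`-algebra. -/
def ParamSpace (p : ℝ≥0∞) (d : ℕ) : Type :=
  ℝ × SeqSpace p × EuclideanSpace ℝ (Fin d) × ℝ

instance (p : ℝ≥0∞) [Fact (1 ≤ p)] (d : ℕ) : TopologicalSpace (ParamSpace p d) :=
  inferInstanceAs (TopologicalSpace (ℝ × SeqSpace p × EuclideanSpace ℝ (Fin d) × ℝ))

instance (p : ℝ≥0∞) [Fact (1 ≤ p)] (d : ℕ) : MeasurableSpace (ParamSpace p d) :=
  borel (ParamSpace p d)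

instance (p : ℝ≥0∞) [Fact (1 ≤ p)] (d : ℕ) : BorelSpace (ParamSpace p d) := ⟨rfl⟩

namespace ParamSpace

variable {p : ℝ≥0∞} {d : ℕ}

/-- The output weight `w`. -/
def w (θ : ParamSpace p d) : ℝ := θ.1

/-- The state weight `a ∈ ℓ^p`. -/
def a (θ : ParamSpace p d) : SeqSpace p := θ.2.1

/-- The input weight `c ∈ ℝ^d`. -/
def c (θ : ParamSpace p d) : EuclideanSpace ℝ (Fin d) := θ.2.2.1

/-- The bias `b`. -/
def b (θ : ParamSpace p d) : ℝ := θ.2.2.2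

end ParamSpace

/-- The pairing `a · x = ∑ i, a_i x_i` of `a ∈ ℓ^p` and `x ∈ ℓ^q`. -/
def pairing {p q : ℝ≥0∞} (a : SeqSpace p) (x : SeqSpace q) : ℝ := ∑' i : ℕ, a i * x i

/-- `x` belongs to `ℓ^∞₋(ℓ^q)` and solves `x_t = σ₁(A x_{t-1} + C z_t + B)` for all `t ∈ ℤ₋`, where
`σ₁` acts componentwise. -/
def IsBoundedSolution {q : ℝ≥0∞} {d : ℕ} (σ₁ : ℝ → ℝ)
    (A : SeqSpace q →ₗ[ℝ] SeqSpace q) (C : EuclideanSpace ℝ (Fin d) →ₗ[ℝ] SeqSpace q)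
    (B : SeqSpace q) (z : InputSeq d) (x : ZMinus → SeqSpace q) : Prop :=
  BddAbove (Set.range fun t => ‖x t‖) ∧
    ∀ (t : ZMinus) (i : ℕ), x t i = σ₁ ((A (x t.pred) + C (z t) + B) i)

/-- The class `𝒞` of recurrent (generalized) Barron functionals `H : I → ℝ`, for activation
functions `σ₁, σ₂` and state space `ℓ^q`. That the integral defining `H z` converges is part of the
definition. -/
def barronClass (p q : ℝ≥0∞) [Fact (1 ≤ p)] (σ₁ σ₂ : ℝ → ℝ) {d : ℕ} (I : Set (InputSeq d)) :
    Set (I → ℝ) :=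
  {H | ∃ (μ : Measure (ParamSpace p d)) (B : SeqSpace q)
      (A : SeqSpace q →ₗ[ℝ] SeqSpace q) (C : EuclideanSpace ℝ (Fin d) →ₗ[ℝ] SeqSpace q),
    IsProbabilityMeasure μ ∧
    (∀ z : I, ∃! x : ZMinus → SeqSpace q, IsBoundedSolution σ₁ A C B z x) ∧
    ∫⁻ θ, ENNReal.ofReal (|θ.w| * (‖θ.a‖ + ‖θ.c‖ + |θ.b|)) ∂μ < ∞ ∧
    ∀ (z : I) (x : ZMinus → SeqSpace q), IsBoundedSolution σ₁ A C B z x →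
      Integrable (fun θ : ParamSpace p d => θ.w *
        σ₂ (pairing θ.a (x ZMinus.zero.pred) + inner ℝ θ.c (z.1 ZMinus.zero) + θ.b)) μ ∧
      H z = ∫ θ, θ.w *
        σ₂ (pairing θ.a (x ZMinus.zero.pred) + inner ℝ θ.c (z.1 ZMinus.zero) + θ.b) ∂μ}

end RecurrentBarron

end

/-! Already the functionals given by finitely supported `μ` and one fixed reservoir are dense. The
reservoir is a delay line whose `k`-th slot stores the input of `k` steps ago damped by `2⁻ᵏ`. The
damping keeps states in every `ℓ^q` and makes the bounded solution unique (`delay_solution`).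
Together with the direct input `z_0`, finitely supported weights read out every linear functional of
finitely many inputs (`dual_mem_range_readout`), and a finite sum of neurons is an integral against
a mixture of Dirac measures (`mem_barronClass_of_mem_span`).

By Hahn-Banach and Radon-Nikodym (`dense_of_forall_density`), it remains to see that an integrable
`g` orthogonal to all bounded combinations of neurons vanishes. ReLU is first replaced by its second
difference, a bounded hat function. For a bounded continuous non-constant activation, averaging over
shifts and dilations passes the orthogonality on to an integrable non-zero profile `S`
(`exists_integrable_profile`). Fourier transformation in the bias then gives `∫ g exp(iℓ) = 0` for
every readout `ℓ` (`Annihilates.integral_exp_eq_zero`). Thus `g⁺γ` and `g⁻γ` have the same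
finite-dimensional marginals, so they coincide and `g = 0` (`ae_eq_zero_of_integral_exp_eq_zero`).
-/

namespace RecurrentBarron

/-! ### Ridge functions: from a bounded profile to characters. -/

section Ridge

open Filter Topology Convolution ContDiff

/-- The signed measure `g • γ` annihilates all ridge functions `z ↦ f (s * ℓ z + b)`. -/
def Annihilates {Z : Type*} [MeasurableSpace Z] (γ : Measure Z) (g ℓ : Z → ℝ) (f : ℝ → ℝ) : Prop :=
  ∀ s b : ℝ, ∫ z, g z * f (s * ℓ z + b) ∂γ = 0

variable {Z : Type*} [MeasurableSpace Z] {γ : Measure Z} {g ℓ : Z → ℝ}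

/-- Affine reparametrizations of the profile only change `s` and `b`, so by Fubini the annihilation
survives averaging over them. -/
lemma Annihilates.integral [SFinite γ] {f : ℝ → ℝ} (h : Annihilates γ g ℓ f)
    (hg : Integrable g γ) (hℓ : Measurable ℓ) (hf : Measurable f) {M : ℝ} (hM : ∀ x, |f x| ≤ M)
    {Y : Type*} [MeasurableSpace Y] {m : Measure Y} [SFinite m] {φ α β : Y → ℝ}
    (hφ : Integrable φ m) (hα : Measurable α) (hβ : Measurable β) :
    Annihilates γ g ℓ (fun t => ∫ y, φ y * f (α y * t + β y) ∂m) := by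
  intro s b
  have hint : Integrable (Function.uncurry fun (z : Z) (y : Y) =>
      g z * (φ y * f (α y * (s * ℓ z + b) + β y))) (γ.prod m) := by
    have h1 : Integrable (fun q : Z × Y => g q.1 * φ q.2) (γ.prod m) := hg.mul_prod hφ
    have h2 := h1.mul_bdd (c := M) (g := fun q : Z × Y => f (α q.2 * (s * ℓ q.1 + b) + β q.2))
      (by
        apply Measurable.aestronglyMeasurable
        exact hf.comp (by fun_prop)) (Eventually.of_forall fun q => hM _)
    refine h2.congr (Eventually.of_forall fun q => ?_)
    simp only [Function.uncurry]
    ring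
  simp only [← integral_const_mul]
  rw [integral_integral_swap hint]
  refine integral_eq_zero_of_ae (Eventually.of_forall fun y => ?_)
  have := h (α y * s) (α y * b + β y)
  calc ∫ z, g z * (φ y * f (α y * (s * ℓ z + b) + β y)) ∂γ
      = ∫ z, φ y * (g z * f (α y * s * ℓ z + (α y * b + β y))) ∂γ := by
        congr 1 with z
        rw [show α y * (s * ℓ z + b) + β y = α y * s * ℓ z + (α y * b + β y) by ring]
        ring
    _ = 0 := by rw [integral_const_mul, this, mul_zero]

/-- A shrinking sequence of bump functions around the origin of the real line. -/
lemma exists_contDiffBump_seq :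
    ∃ φ : ℕ → ContDiffBump (0 : ℝ), Tendsto (fun n => (φ n).rOut) atTop (𝓝 0) := by
  refine ⟨fun n => ⟨1 / (2 * ((n : ℝ) + 1)), 1 / ((n : ℝ) + 1), by positivity, ?_⟩,
    tendsto_one_div_add_atTop_nhds_zero_nat⟩
  apply one_div_lt_one_div_of_lt <;> linarith [(Nat.cast_nonneg n : (0 : ℝ) ≤ n)]

lemma abs_convolution_le {σ φ : ℝ → ℝ} {M : ℝ} (hM : ∀ x, |σ x| ≤ M) (hφ : Integrable φ)
    (x : ℝ) : |(φ ⋆[ContinuousLinearMap.lsmul ℝ ℝ, volume] σ) x| ≤ (∫ y, |φ y|) * M := by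
  rw [convolution_def, ← integral_mul_const, ← Real.norm_eq_abs]
  refine norm_integral_le_of_norm_le (hφ.abs.mul_const M) (Eventually.of_forall fun y => ?_)
  simp only [ContinuousLinearMap.lsmul_apply, smul_eq_mul, norm_mul, Real.norm_eq_abs]
  exact mul_le_mul_of_nonneg_left (hM _) (abs_nonneg _)

/-- A twice differentiable bounded function with vanishing second derivative is constant. -/
lemma eq_of_bounded_of_deriv_deriv_eq_zero {K : ℝ → ℝ} (hK : ContDiff ℝ 2 K) {M : ℝ}
    (hM : ∀ x, |K x| ≤ M) (h : ∀ x, deriv (deriv K) x = 0) (x y : ℝ) : K x = K y := by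
  have hd : Differentiable ℝ K := hK.differentiable (by norm_num)
  have hd' : Differentiable ℝ (deriv K) := by
    have : ContDiff ℝ (1 + 1) K := by simpa [one_add_one_eq_two] using hK
    exact ((contDiff_succ_iff_deriv.1 this).2.2).differentiable (by norm_num)
  have hc : ∀ x, deriv K x = deriv K 0 := fun x => is_const_of_deriv_eq_zero hd' h x 0
  set c := deriv K 0
  have hlin : ∀ x, K x - c * x = K 0 := by
    intro x
    have := is_const_of_deriv_eq_zero (f := fun x => K x - c * x) (by fun_prop)
      (fun x => by
        rw [deriv_fun_sub (hd x) (by fun_prop), hc x, deriv_const_mul_field]; simp) x 0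
    simpa using this
  have hc0 : c = 0 := by
    by_contra hne
    -- At this point the linear part equals `2M + 1`, more than the oscillation `2M` that the bound
    -- allows.
    have h1 := hM ((2 * M + 1) / c)
    have h0 := hM 0
    have h2 := hlin ((2 * M + 1) / c)
    rw [mul_div_cancel₀ _ hne] at h2
    rw [abs_le] at h1 h0
    linarith
  have hx := hlin x
  have hy := hlin y
  rw [hc0] at hx hy
  linarith

/-- A bounded continuous non-constant function has a mollification whose second derivative does not
vanish identically. -/
lemma exists_mollifier {σ : ℝ → ℝ} (hσ : Continuous σ) {M : ℝ} (hM : ∀ x, |σ x| ≤ M)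
    (hne : ∃ x y, σ x ≠ σ y) :
    ∃ ψ : ℝ → ℝ, ContDiff ℝ ∞ ψ ∧ HasCompactSupport ψ ∧
      ∃ x, (deriv (deriv ψ) ⋆[ContinuousLinearMap.lsmul ℝ ℝ, volume] σ) x ≠ 0 := by
  obtain ⟨x, y, hxy⟩ := hne
  obtain ⟨φ, hφ⟩ := exists_contDiffBump_seq
  by_contra hcon
  push Not at hcon
  apply hxy
  -- If all the second derivatives vanish, each mollification of `σ` is bounded and affine, hence
  -- constant; the limit forces `σ x = σ y`.
  have key : ∀ n, (((φ n).normed volume) ⋆[ContinuousLinearMap.lsmul ℝ ℝ, volume] σ) x =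
      (((φ n).normed volume) ⋆[ContinuousLinearMap.lsmul ℝ ℝ, volume] σ) y := by
    intro n
    have hs : ContDiff ℝ ∞ ((φ n).normed volume) := (φ n).contDiff_normed
    have hc : HasCompactSupport ((φ n).normed volume) := (φ n).hasCompactSupport_normed
    have hli : LocallyIntegrable σ volume := hσ.locallyIntegrable
    have hs' : ContDiff ℝ ∞ (deriv ((φ n).normed volume)) := (contDiff_infty_iff_deriv.1 hs).2
    have e1 : deriv (((φ n).normed volume) ⋆[ContinuousLinearMap.lsmul ℝ ℝ, volume] σ) =
        (deriv ((φ n).normed volume)) ⋆[ContinuousLinearMap.lsmul ℝ ℝ, volume] σ :=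
      funext fun x => (hc.hasDerivAt_convolution_left _ (hs.of_le (by norm_num)) hli x).deriv
    have e2 : deriv ((deriv ((φ n).normed volume)) ⋆[ContinuousLinearMap.lsmul ℝ ℝ, volume] σ) =
        (deriv (deriv ((φ n).normed volume))) ⋆[ContinuousLinearMap.lsmul ℝ ℝ, volume] σ :=
      funext fun x => (hc.deriv.hasDerivAt_convolution_left _ (hs'.of_le (by norm_num)) hli x).deriv
    refine eq_of_bounded_of_deriv_deriv_eq_zero
      (hc.contDiff_convolution_left _
        (hs.of_le (by exact_mod_cast le_top) : ContDiff ℝ (2 : ℕ∞) _) hli)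
      (abs_convolution_le hM (hs.continuous.integrable_of_hasCompactSupport hc)) ?_ x y
    intro t
    rw [e1, e2]
    exact hcon _ hs hc t
  have hx := ContDiffBump.convolution_tendsto_right_of_continuous (μ := volume) hφ hσ x
  have hy := ContDiffBump.convolution_tendsto_right_of_continuous (μ := volume) hφ hσ y
  simp only [key] at hx
  exact tendsto_nhds_unique hx hy

/-- Averaging the dilations of a second derivative of a bounded function yields quadratic decay. -/
lemma sq_mul_integral_dilation {χ K K' K'' : ℝ → ℝ} (hχ : ContDiff ℝ ∞ χ)
    (hcs : HasCompactSupport χ) (hK : ∀ x, HasDerivAt K (K' x) x)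
    (hK' : ∀ x, HasDerivAt K' (K'' x) x) (hK'' : Continuous K'') (t : ℝ) :
    t ^ 2 * ∫ s, χ s * K'' (s * t) = ∫ s, deriv (deriv χ) s * K (s * t) := by
  have hχ' : ContDiff ℝ ∞ (deriv χ) := (contDiff_infty_iff_deriv.1 hχ).2
  have hχ'' : ContDiff ℝ ∞ (deriv (deriv χ)) := (contDiff_infty_iff_deriv.1 hχ').2
  have cK : Continuous K := continuous_iff_continuousAt.2 fun x => (hK x).continuousAt
  have cK' : Continuous K' := continuous_iff_continuousAt.2 fun x => (hK' x).continuousAt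
  have scale : ∀ {F F' : ℝ → ℝ}, (∀ x, HasDerivAt F (F' x) x) →
      ∀ s, HasDerivAt (fun s => F (s * t)) (t * F' (s * t)) s := by
    intro F F' hF s
    have := (hF (s * t)).comp s ((hasDerivAt_id s).mul_const t)
    simpa [mul_comm, Function.comp_def] using this
  have int : ∀ {u v : ℝ → ℝ}, Continuous u → HasCompactSupport u → Continuous v →
      Integrable (u * v) := fun hu hc hv =>
    (hu.mul hv).integrable_of_hasCompactSupport hc.mul_right
  -- Each integration by parts in `s` absorbs one factor `t`; the compact support of `χ` removes
  -- boundary terms.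
  have i1 := integral_mul_deriv_eq_deriv_mul_of_integrable (u := χ) (u' := deriv χ)
    (v := fun s => K' (s * t)) (v' := fun s => t * K'' (s * t))
    (fun s _ => (hχ.differentiable (by simp) s).hasDerivAt) (fun s _ => scale hK' s)
    (int hχ.continuous hcs (by fun_prop)) (int hχ'.continuous hcs.deriv (by fun_prop))
    (int hχ.continuous hcs (by fun_prop))
  have i2 := integral_mul_deriv_eq_deriv_mul_of_integrable (u := deriv χ) (u' := deriv (deriv χ))
    (v := fun s => K (s * t)) (v' := fun s => t * K' (s * t))
    (fun s _ => (hχ'.differentiable (by simp) s).hasDerivAt) (fun s _ => scale hK s)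
    (int hχ'.continuous hcs.deriv (by fun_prop)) (int hχ''.continuous hcs.deriv.deriv (by fun_prop))
    (int hχ'.continuous hcs.deriv (by fun_prop))
  have e1 : (∫ s, χ s * (t * K'' (s * t))) = t * ∫ s, χ s * K'' (s * t) := by
    rw [← integral_const_mul]; congr 1 with s; ring
  have e2 : (∫ s, deriv χ s * (t * K' (s * t))) = t * ∫ s, deriv χ s * K' (s * t) := by
    rw [← integral_const_mul]; congr 1 with s; ring
  rw [e1] at i1
  rw [e2] at i2
  rw [pow_two, mul_assoc, i1, mul_neg, i2, neg_neg]

/-- Every measure that annihilates the ridge functions of a bounded continuous non-constant profile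
also annihilates those of some integrable continuous non-zero profile. -/
lemma exists_integrable_profile {σ : ℝ → ℝ} (hσ : Continuous σ) {M : ℝ} (hM : ∀ x, |σ x| ≤ M)
    (hne : ∃ x y, σ x ≠ σ y) :
    ∃ S : ℝ → ℝ, Continuous S ∧ Integrable S ∧ (∃ t, S t ≠ 0) ∧
      ∀ {Z : Type} [MeasurableSpace Z] {γ : Measure Z} [SFinite γ] {g ℓ : Z → ℝ},
        Integrable g γ → Measurable ℓ → Annihilates γ g ℓ σ → Annihilates γ g ℓ S := by
  obtain ⟨ψ, hψ, hψc, x₀, hx₀⟩ := exists_mollifier hσ hM hne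
  have hψ' : ContDiff ℝ ∞ (deriv ψ) := (contDiff_infty_iff_deriv.1 hψ).2
  have hψ'' : ContDiff ℝ ∞ (deriv (deriv ψ)) := (contDiff_infty_iff_deriv.1 hψ').2
  have hli : LocallyIntegrable σ volume := hσ.locallyIntegrable
  set L := ContinuousLinearMap.lsmul ℝ ℝ (E := ℝ) with hL
  set K := ψ ⋆[L, volume] σ
  set K' := deriv ψ ⋆[L, volume] σ
  set K'' := deriv (deriv ψ) ⋆[L, volume] σ
  have hK : ∀ x, HasDerivAt K (K' x) x := fun x =>
    hψc.hasDerivAt_convolution_left _ (hψ.of_le (by norm_num)) hli x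
  have hK' : ∀ x, HasDerivAt K' (K'' x) x := fun x =>
    hψc.deriv.hasDerivAt_convolution_left _ (hψ'.of_le (by norm_num)) hli x
  have iψ : Integrable ψ := hψ.continuous.integrable_of_hasCompactSupport hψc
  have iψ'' : Integrable (deriv (deriv ψ)) :=
    hψ''.continuous.integrable_of_hasCompactSupport hψc.deriv.deriv
  have cK'' : Continuous K'' :=
    hψc.deriv.deriv.continuous_convolution_left _ hψ''.continuous hli
  have bK := abs_convolution_le hM iψ
  have bK'' := abs_convolution_le hM iψ''
  obtain ⟨φ, hφ⟩ := exists_contDiffBump_seq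
  obtain ⟨n, hn⟩ : ∃ n, (((φ n).normed volume) ⋆[L, volume] K'') x₀ ≠ 0 := by
    have := ContDiffBump.convolution_tendsto_right_of_continuous (μ := volume) hφ cK'' x₀
    exact (this.eventually_ne hx₀).exists
  -- The reflection about `x₀` makes `S 1` below equal to the mollification of `K''` at `x₀`, which
  -- is non-zero.
  set χ : ℝ → ℝ := fun s => (φ n).normed volume (x₀ - s) with hχdef
  have hχ : ContDiff ℝ ∞ χ := (φ n).contDiff_normed.comp (contDiff_const.sub contDiff_id)
  have hχc : HasCompactSupport χ := by
    have := (φ n).hasCompactSupport_normed (μ := (volume : Measure ℝ))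
    exact this.comp_homeomorph (Homeomorph.subLeft x₀)
  have hχ' : ContDiff ℝ ∞ (deriv χ) := (contDiff_infty_iff_deriv.1 hχ).2
  have hχ'' : ContDiff ℝ ∞ (deriv (deriv χ)) := (contDiff_infty_iff_deriv.1 hχ').2
  have iχ : Integrable χ := hχ.continuous.integrable_of_hasCompactSupport hχc
  have iχ'' : Integrable (deriv (deriv χ)) :=
    hχ''.continuous.integrable_of_hasCompactSupport hχc.deriv.deriv
  have bound : ∀ {u v : ℝ → ℝ} {C : ℝ}, Integrable u → (∀ x, |v x| ≤ C) → ∀ t : ℝ,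
      |∫ s, u s * v (s * t)| ≤ (∫ s, |u s|) * C := by
    intro u v C hu hv t
    rw [← integral_mul_const, ← Real.norm_eq_abs]
    refine norm_integral_le_of_norm_le (hu.abs.mul_const C) (Eventually.of_forall fun y => ?_)
    simp only [norm_mul, Real.norm_eq_abs]
    exact mul_le_mul_of_nonneg_left (hv _) (abs_nonneg _)
  set S : ℝ → ℝ := fun t => ∫ s, χ s * K'' (s * t) with hS
  have cS : Continuous S := by
    refine continuous_of_dominated (bound := fun s => |χ s| * ((∫ y, |deriv (deriv ψ) y|) * M))
      (fun t => (hχ.continuous.mul (by fun_prop)).aestronglyMeasurable)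
      (fun t => Eventually.of_forall fun s => ?_) (iχ.abs.mul_const _)
      (Eventually.of_forall fun s => by fun_prop)
    simp only [norm_mul, Real.norm_eq_abs]
    exact mul_le_mul_of_nonneg_left (bK'' _) (abs_nonneg _)
  refine ⟨S, cS, ?_, ⟨1, ?_⟩, ?_⟩
  -- Both `S` and `t² S` are bounded, so `S` is dominated by a multiple of `1 / (1 + t²)`.
  · refine (integrable_inv_one_add_sq.const_mul
      ((∫ s, |χ s|) * ((∫ y, |deriv (deriv ψ) y|) * M) +
        (∫ s, |deriv (deriv χ) s|) * ((∫ y, |ψ y|) * M))).mono' cS.aestronglyMeasurable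
      (Eventually.of_forall fun t => ?_)
    have h1 := bound iχ bK'' t
    have h2 := bound iχ'' bK t
    rw [← sq_mul_integral_dilation hχ hχc hK hK' cK'' t, abs_mul, abs_of_nonneg (sq_nonneg t)] at h2
    rw [← div_eq_mul_inv, le_div_iff₀ (by positivity), Real.norm_eq_abs, mul_add, mul_one,
      mul_comm _ (t ^ 2)]
    exact add_le_add h1 h2
  · have : S 1 = (((φ n).normed volume) ⋆[L, volume] K'') x₀ := by
      rw [convolution_def, ← integral_sub_left_eq_self _ volume x₀]
      simp [hS, hχdef, hL]
    rwa [this]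
  · intro Z _ γ _ g ℓ hg hℓ h
    -- Averaging over shifts leads from `σ` to `K''`; averaging over dilations then leads to `S`.
    have h1 : Annihilates γ g ℓ K'' := by
      have := h.integral hg hℓ hσ.measurable hM iψ'' (α := fun _ => 1) (β := fun y => -y)
        measurable_const measurable_neg
      convert this using 2 with t
      simp [K'', convolution_def, hL, sub_eq_add_neg]
    have h2 := h1.integral hg hℓ cK''.measurable bK'' iχ (α := fun s => s) (β := fun _ => 0)
      measurable_id measurable_const
    simpa using h2

/-- The Fourier transform of a non-zero continuous integrable function is non-zero somewhere away
from the origin. -/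
lemma exists_fourier_ne_zero {S : ℝ → ℂ} (cS : Continuous S) (hS : Integrable S)
    (hne : ∃ t, S t ≠ 0) : ∃ w : ℝ, w ≠ 0 ∧ FourierTransform.fourier S w ≠ 0 := by
  by_contra hcon
  push Not at hcon
  have hcont : Continuous (FourierTransform.fourier S : ℝ → ℂ) :=
    VectorFourier.fourierIntegral_continuous Real.continuous_fourierChar
      (by exact continuous_inner) hS
  -- Continuity extends the vanishing to the origin, and Fourier inversion then gives `S = 0`.
  have hzero : (FourierTransform.fourier S : ℝ → ℂ) = 0 := by
    refine Continuous.ext_on (dense_compl_singleton (0 : ℝ)) hcont continuous_const ?_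
    intro w hw
    exact hcon w hw
  obtain ⟨t, ht⟩ := hne
  apply ht
  have := cS.fourierInv_fourier_eq hS (by rw [hzero]; exact integrable_zero _ _ _)
  rw [← this, hzero, Real.fourierInv_eq]
  simp

/-- If `g • γ` annihilates the ridge functions of an integrable non-zero profile, then its
characteristic function vanishes along the ridge direction. -/
lemma Annihilates.integral_exp_eq_zero [SFinite γ] {S : ℝ → ℝ} (h : Annihilates γ g ℓ S)
    (hg : Integrable g γ) (hℓ : Measurable ℓ) (cS : Continuous S) (hS : Integrable S)
    (hne : ∃ t, S t ≠ 0) : ∫ z, (g z : ℂ) * Complex.exp (ℓ z * Complex.I) ∂γ = 0 := by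
  obtain ⟨w, hw, hFw⟩ := exists_fourier_ne_zero (S := fun t => (S t : ℂ)) (by fun_prop) hS.ofReal
    (by simpa using hne)
  set F : ℂ := FourierTransform.fourier (fun t => (S t : ℂ)) w with hF
  -- With this dilation, translating `b` by `s * ℓ z` produces exactly the phase `exp(iℓ z)`; this
  -- is where `w ≠ 0` is needed.
  set s : ℝ := (2 * Real.pi * w)⁻¹ with hs
  have hsw : 2 * Real.pi * w * s = 1 := by
    rw [hs]; apply mul_inv_cancel₀; have := Real.pi_pos; positivity
  set e : ℝ → ℂ := fun v => Complex.exp (((-2 * Real.pi * v * w : ℝ) : ℂ) * Complex.I) with he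
  have hFe : F = ∫ v, e v * (S v : ℂ) := by
    rw [hF, Real.fourier_real_eq_integral_exp_smul]; rfl
  have ne : ∀ v, ‖e v‖ = 1 := fun v => Complex.norm_exp_ofReal_mul_I _
  have ce : Continuous e := by fun_prop
  have shift : ∀ z, ∫ b, e b * (S (s * ℓ z + b) : ℂ) = Complex.exp (ℓ z * Complex.I) * F := by
    intro z
    rw [hFe, ← integral_const_mul,
      ← integral_add_left_eq_self (μ := volume)
        (fun v => Complex.exp (ℓ z * Complex.I) * (e v * (S v : ℂ))) (s * ℓ z)]
    congr 1 with b
    have : e b = Complex.exp (ℓ z * Complex.I) * e (s * ℓ z + b) := by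
      have hz : -2 * Real.pi * b * w = ℓ z + -2 * Real.pi * (s * ℓ z + b) * w := by
        linear_combination ℓ z * hsw
      rw [he, ← Complex.exp_add, ← add_mul, ← Complex.ofReal_add, ← hz]
    rw [this]
    ring
  have hint : Integrable (Function.uncurry fun (z : Z) (b : ℝ) =>
      (g z : ℂ) * (e b * (S (s * ℓ z + b) : ℂ))) (γ.prod volume) := by
    have hm : AEStronglyMeasurable (Function.uncurry fun (z : Z) (b : ℝ) =>
        (g z : ℂ) * (e b * (S (s * ℓ z + b) : ℂ))) (γ.prod volume) := by
      refine AEStronglyMeasurable.mul ?_ (Measurable.aestronglyMeasurable ?_)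
      · exact (Complex.continuous_ofReal.comp_aestronglyMeasurable hg.1).comp_fst
      · refine (ce.measurable.comp measurable_snd).mul
          (Complex.measurable_ofReal.comp (cS.measurable.comp ?_))
        fun_prop
    rw [integrable_prod_iff hm]
    refine ⟨Eventually.of_forall fun z => ?_, ?_⟩
    · have h1 : Integrable fun b => (S (s * ℓ z + b) : ℂ) := (hS.comp_add_left (s * ℓ z)).ofReal
      change Integrable (fun b => (g z : ℂ) * (e b * (S (s * ℓ z + b) : ℂ)))
      refine Integrable.const_mul ?_ _
      exact h1.bdd_mul (c := 1) ce.aestronglyMeasurable (Eventually.of_forall fun v => (ne v).le)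
    · have : ∀ z, ∫ b, ‖(g z : ℂ) * (e b * (S (s * ℓ z + b) : ℂ))‖ = |g z| * ∫ b, |S b| := by
        intro z
        rw [← integral_const_mul,
          ← integral_add_left_eq_self (μ := volume) (fun b => |g z| * |S b|) (s * ℓ z)]
        simp [ne]
      simp only [Function.uncurry, this]
      exact hg.abs.mul_const _
  have hzero : ∫ z, (g z : ℂ) * (Complex.exp (ℓ z * Complex.I) * F) ∂γ = 0 := by
    simp only [← shift, ← integral_const_mul]
    rw [integral_integral_swap hint]
    refine integral_eq_zero_of_ae (Eventually.of_forall fun b => ?_)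
    have : ∀ z, (g z : ℂ) * (e b * (S (s * ℓ z + b) : ℂ)) =
        e b * ((g z * S (s * ℓ z + b) : ℝ) : ℂ) := fun z => by push_cast; ring
    simp only [this]
    rw [integral_const_mul, integral_complex_ofReal, h s b]
    simp
  simp only [← mul_assoc] at hzero
  rw [integral_mul_const] at hzero
  exact (mul_eq_zero.1 hzero).resolve_right hFw

end Ridge

/-! ### Functionals on `L^r` and a density criterion. -/

section Duality

open Filter Topology

variable {Z : Type*} [MeasurableSpace Z] {γ : Measure Z} {r : ℝ≥0∞}

lemma memLp_of_bounded [IsFiniteMeasure γ] {f : Z → ℝ} (hf : Measurable f) {M : ℝ}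
    (hM : ∀ x, |f x| ≤ M) : MemLp f r γ :=
  MemLp.of_bound hf.aestronglyMeasurable M (Eventually.of_forall hM)

/-- The signed measure `s ↦ F (𝟙_s)` of a continuous linear functional `F` on `L^r`. -/
noncomputable def dualSignedMeasure [IsFiniteMeasure γ] [Fact (1 ≤ r)] (hr : r ≠ ∞)
    (F : StrongDual ℝ (Lp ℝ r γ)) : SignedMeasure Z where
  measureOf' s := by
    classical
    exact if hs : MeasurableSet s then F (indicatorConstLp r hs (measure_ne_top γ s) 1) else 0
  empty' := by simp
  not_measurable' s hs := by simp [hs]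
  m_iUnion' f hf hd := by
    have hU : MeasurableSet (⋃ i, f i) := MeasurableSet.iUnion hf
    have hfin : ∀ b : Finset ℕ, MeasurableSet (⋃ i ∈ b, f i) :=
      fun b => b.measurableSet_biUnion fun i _ => hf i
    simp only [hU, hf, dif_pos]
    have hsum : ∀ b : Finset ℕ,
        ∑ i ∈ b, F (indicatorConstLp r (hf i) (measure_ne_top γ _) 1) =
          F (indicatorConstLp r (hfin b) (measure_ne_top γ _) 1) := by
      classical
      intro b
      induction b using Finset.induction_on with
      | empty => simp
      | insert a b ha ih =>
        rw [Finset.sum_insert ha, ih, ← map_add, ← indicatorConstLp_disjoint_union]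
        · congr 2
          simp
        · rw [Set.disjoint_iUnion₂_right]
          intro i hi
          exact hd (by rintro rfl; exact ha hi)
    rw [HasSum]
    simp only [SummationFilter.unconditional_filter]
    simp_rw [hsum]
    refine (F.continuous.tendsto _).comp (tendsto_indicatorConstLp_set hr ?_)
    -- For `r < ∞`, indicators converge in `L^r` once the measures of the symmetric differences tend
    -- to zero.
    have hlim : Tendsto (fun b : Finset ℕ => γ ((⋃ i, f i) \ ⋃ i ∈ b, f i)) atTop (𝓝 0) := by
      have hempty : ⋂ b : Finset ℕ, ((⋃ i, f i) \ ⋃ i ∈ b, f i) = ∅ := by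
        ext x
        simp only [Set.mem_iInter, Set.mem_sdiff, Set.mem_iUnion, Set.mem_empty_iff_false,
          iff_false, not_forall]
        by_contra hcon
        push Not at hcon
        obtain ⟨⟨i, hi⟩, _⟩ := hcon ∅
        exact (hcon {i}).2 i (by simp) hi
      have := tendsto_measure_iInter_atTop (μ := γ)
        (s := fun b : Finset ℕ => (⋃ i, f i) \ ⋃ i ∈ b, f i)
        (fun b => (hU.diff (hfin b)).nullMeasurableSet)
        (fun b c hbc => Set.sdiff_subset_sdiff_right (Set.biUnion_subset_biUnion_left hbc))
        ⟨∅, measure_ne_top _ _⟩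
      rwa [hempty, measure_empty] at this
    refine hlim.congr fun b => ?_
    congr 1
    have hsub : ⋃ i ∈ b, f i ⊆ ⋃ i, f i := Set.iUnion₂_subset fun i _ => Set.subset_iUnion f i
    rw [Set.symmDiff_def, Set.sdiff_eq_empty.2 hsub, Set.empty_union]

lemma dualSignedMeasure_apply [IsFiniteMeasure γ] [Fact (1 ≤ r)] (hr : r ≠ ∞)
    (F : StrongDual ℝ (Lp ℝ r γ)) {s : Set Z} (hs : MeasurableSet s) :
    dualSignedMeasure hr F s = F (indicatorConstLp r hs (measure_ne_top γ s) 1) := by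
  exact dif_pos hs

/-- Uniformly bounded pointwise convergence implies convergence in `L^r`. -/
lemma tendsto_toLp_of_bounded [IsFiniteMeasure γ] [Fact (1 ≤ r)] (hr : r ≠ ∞)
    {f : ℕ → Z → ℝ} {f₀ : Z → ℝ} (hf : ∀ n, MemLp (f n) r γ) (hf₀ : MemLp f₀ r γ) {M : ℝ}
    (hM : ∀ n x, |f n x| ≤ M) (hlim : ∀ x, Tendsto (fun n => f n x) atTop (𝓝 (f₀ x))) :
    Tendsto (fun n => (hf n).toLp (f n)) atTop (𝓝 (hf₀.toLp f₀)) := by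
  rw [Lp.tendsto_Lp_iff_tendsto_eLpNorm'']
  refine tendsto_Lp_finite_of_tendsto_ae (Fact.out) hr (fun n => (hf n).1) hf₀ ?_
    (Eventually.of_forall hlim)
  refine unifIntegrable_of Fact.out hr (fun n => (hf n).1)
    -- A threshold strictly above the uniform bound makes every tail set empty.
    fun ε hε => ⟨(|M| + 1).toNNReal, fun n => ?_⟩
  have : {x | (|M| + 1).toNNReal ≤ ‖f n x‖₊} = ∅ := by
    ext x
    simp only [Set.mem_ofPred_eq, Set.mem_empty_iff_false, iff_false, not_le]
    rw [← NNReal.coe_lt_coe, Real.coe_toNNReal _ (by positivity), coe_nnnorm, Real.norm_eq_abs]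
    linarith [hM n x, le_abs_self M]
  rw [this]
  simp

/-- On bounded measurable functions, a continuous linear functional on `L^r`, `r < ∞`, is the
integral against an integrable density. -/
lemma exists_density [IsFiniteMeasure γ] [Fact (1 ≤ r)] (hr : r ≠ ∞)
    (F : StrongDual ℝ (Lp ℝ r γ)) :
    ∃ g : Z → ℝ, Integrable g γ ∧ ∀ (f : Z → ℝ) (hf : MemLp f r γ), Measurable f →
      ∀ M : ℝ, (∀ x, |f x| ≤ M) → F (hf.toLp f) = ∫ z, g z * f z ∂γ := by
  set s := dualSignedMeasure hr F
  have hac : s ≪ᵥ γ.toENNRealVectorMeasure := by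
    refine VectorMeasure.AbsolutelyContinuous.mk fun t ht h0 => ?_
    rw [Measure.toENNRealVectorMeasure_apply_measurable ht] at h0
    rw [dualSignedMeasure_apply hr F ht]
    have : indicatorConstLp r ht (measure_ne_top γ t) (1 : ℝ) = 0 := by
      rw [← norm_eq_zero, norm_indicatorConstLp (by have := (Fact.out : 1 ≤ r); positivity) hr]
      simp only [Measure.real, h0]
      have : 1 / r.toReal ≠ 0 := by
        have := ENNReal.toReal_pos (by have := (Fact.out : 1 ≤ r); positivity) hr
        positivity
      rw [ENNReal.toReal_zero, Real.zero_rpow this, mul_zero]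
    rw [this, map_zero]
  have hrn := SignedMeasure.withDensityᵥ_rnDeriv_eq s γ hac
  set g := s.rnDeriv γ
  have hg : Integrable g γ := SignedMeasure.integrable_rnDeriv _ _
  have hind : ∀ t (ht : MeasurableSet t),
      F (indicatorConstLp r ht (measure_ne_top γ t) 1) = ∫ z in t, g z ∂γ := by
    intro t ht
    rw [← dualSignedMeasure_apply hr F ht, ← withDensityᵥ_apply hg ht, hrn]
  have hmem : ∀ f : SimpleFunc Z ℝ, MemLp f r γ := fun f => f.memLp_of_isFiniteMeasure r γ
  have bdd : ∀ f : SimpleFunc Z ℝ, Integrable (fun z => g z * f z) γ := fun f => by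
    obtain ⟨C, hC⟩ := f.exists_forall_norm_le
    exact hg.mul_bdd (c := C) f.measurable.aestronglyMeasurable (Eventually.of_forall hC)
  have hsimple : ∀ f : SimpleFunc Z ℝ, F ((hmem f).toLp f) = ∫ z, g z * f z ∂γ := by
    intro f
    induction f using SimpleFunc.induction with
    | const c hs =>
      rename_i t
      have e : (hmem (SimpleFunc.piecewise t hs (.const _ c) (.const _ 0))).toLp _ =
          c • indicatorConstLp r hs (measure_ne_top γ t) (1 : ℝ) := by
        rw [indicatorConstLp, ← MemLp.toLp_const_smul]
        congr 1
        ext x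
        by_cases hx : x ∈ t <;> simp [hx]
      rw [e, map_smul, hind t hs, smul_eq_mul, ← integral_const_mul, ← integral_indicator hs]
      congr 1 with x
      by_cases hx : x ∈ t <;> simp [hx, mul_comm]
    | add hd hf hg' =>
      rename_i f₁ f₂
      have e : (hmem (f₁ + f₂)).toLp (f₁ + f₂ : SimpleFunc Z ℝ) =
        (hmem f₁).toLp f₁ + (hmem f₂).toLp f₂ := rfl
      rw [e, map_add, hf, hg', ← integral_add (bdd f₁) (bdd f₂)]
      congr 1 with x
      simp [mul_add]
  refine ⟨g, hg, fun f hf hfm M hM => ?_⟩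
  -- A point of `Z` is needed to know `0 ≤ M`.
  rcases isEmpty_or_nonempty Z with hZ | ⟨⟨z₀⟩⟩
  · have e : hf.toLp f = 0 := by
      refine Lp.ext (Eventually.of_forall fun x => hZ.elim x)
    rw [e, map_zero, integral_of_isEmpty]
  have hM0 : 0 ≤ M := (abs_nonneg _).trans (hM z₀)
  have hsm : StronglyMeasurable f := hfm.stronglyMeasurable
  have hb : ∀ n x, ‖hsm.approxBounded M n x‖ ≤ M := hsm.norm_approxBounded_le hM0
  have hl : ∀ x, Tendsto (fun n => hsm.approxBounded M n x) atTop (𝓝 (f x)) :=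
    fun x => hsm.tendsto_approxBounded_of_norm_le (hM x)
  have t1 : Tendsto (fun n => F ((hmem (hsm.approxBounded M n)).toLp _)) atTop
      (𝓝 (F (hf.toLp f))) :=
    (F.continuous.tendsto _).comp (tendsto_toLp_of_bounded hr (fun n => hmem _) hf hb hl)
  have t2 : Tendsto (fun n => ∫ z, g z * hsm.approxBounded M n z ∂γ) atTop
      (𝓝 (∫ z, g z * f z ∂γ)) := by
    refine tendsto_integral_of_dominated_convergence (fun z => |g z| * M)
      (fun n => (bdd _).1) (hg.abs.mul_const M) (fun n => Eventually.of_forall fun z => ?_)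
      (Eventually.of_forall fun z => (hl z).const_mul _)
    rw [norm_mul, Real.norm_eq_abs]
    exact mul_le_mul_of_nonneg_left (hb n z) (abs_nonneg _)
  simp only [hsimple] at t1
  exact tendsto_nhds_unique t1 t2

/-- A subspace of `L^r`, `r < ∞`, is dense as soon as no non-zero integrable density annihilates
its bounded elements. -/
lemma dense_of_forall_density [IsFiniteMeasure γ] [Fact (1 ≤ r)] (hr : r ≠ ∞)
    (V : Submodule ℝ (Lp ℝ r γ))
    (h : ∀ g : Z → ℝ, Integrable g γ →
      (∀ (f : Z → ℝ) (hf : MemLp f r γ), Measurable f → (∃ M : ℝ, ∀ x, |f x| ≤ M) →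
        hf.toLp f ∈ V → ∫ z, g z * f z ∂γ = 0) → g =ᵐ[γ] 0) :
    Dense (V : Set (Lp ℝ r γ)) := by
  by_contra hcon
  obtain ⟨x, hx⟩ : ∃ x, x ∉ V.topologicalClosure := by
    by_contra hall
    push Not at hall
    exact hcon (Submodule.dense_iff_topologicalClosure_eq_top.2 (eq_top_iff.2 fun x _ => hall x))
  obtain ⟨F, u, hF, hux⟩ := geometric_hahn_banach_closed_point
    V.topologicalClosure.convex V.isClosed_topologicalClosure hx
  have hu : 0 < u := by simpa using hF 0 (zero_mem _)
  have hFV : ∀ v ∈ V, F v = 0 := by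
    intro v hv
    by_contra hne
    -- This multiple of `v` has value exactly `u`, against the strict bound.
    have := hF ((u / F v) • v) (V.le_topologicalClosure (V.smul_mem _ hv))
    rw [map_smul, smul_eq_mul, div_mul_cancel₀ _ hne] at this
    exact lt_irrefl _ this
  obtain ⟨g, hg, hrep⟩ := exists_density hr F
  have hg0 : g =ᵐ[γ] 0 := by
    refine h g hg fun f hf hfm ⟨M, hM⟩ hfV => ?_
    rw [← hrep f hf hfm M hM]
    exact hFV _ hfV
  have hF0 : F = 0 := by
    refine ContinuousLinearMap.ext fun f => ?_
    induction f using Lp.induction hr with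
    | indicatorConst c hs hμs =>
      rename_i t
      rw [Lp.simpleFunc.coe_indicatorConst, indicatorConstLp,
        hrep _ _ (measurable_const.indicator hs) |c| fun x => by
          by_cases hx : x ∈ t <;> simp [hx]]
      refine integral_eq_zero_of_ae ?_
      filter_upwards [hg0] with z hz
      simp [hz]
    | add f₁ f₂ hd h₁ h₂ => rw [map_add, h₁, h₂]; simp
    | isClosed => exact isClosed_eq F.continuous continuous_const
  rw [hF0] at hux
  simp only [zero_apply] at hux
  linarith

end Duality

/-! ### Uniqueness from finite-dimensional characteristic functions. -/

section Uniqueness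

open Filter

/-- An integrable density on a set of input sequences vanishes if the characteristic functions of
all its finite-dimensional marginals do. -/
lemma ae_eq_zero_of_integral_exp_eq_zero {d : ℕ} {I : Set (InputSeq d)} {γ : Measure I}
    [IsFiniteMeasure γ] {g : I → ℝ} (hg : Integrable g γ)
    (h : ∀ (J : Finset ZMinus) (L : StrongDual ℝ (J → EuclideanSpace ℝ (Fin d))),
      ∫ z : I, (g z : ℂ) * Complex.exp ((L (J.restrict z.1) : ℝ) * Complex.I) ∂γ = 0) :
    g =ᵐ[γ] 0 := by
  set μ := γ.withDensity fun z => ENNReal.ofReal (g z)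
  set ν := γ.withDensity fun z => ENNReal.ofReal (-g z)
  have hμ : IsFiniteMeasure μ := isFiniteMeasure_withDensity_ofReal hg.2
  have hν : IsFiniteMeasure ν := isFiniteMeasure_withDensity_ofReal hg.neg.2
  have hval : Measurable (Subtype.val : I → InputSeq d) := measurable_subtype_coe
  have hres : ∀ J : Finset ZMinus,
      Measurable (J.restrict : InputSeq d → (J → EuclideanSpace ℝ (Fin d))) :=
    fun J => measurable_pi_lambda _ fun _ => measurable_pi_apply _
  have hmarg : ∀ J : Finset ZMinus,
      (μ.map Subtype.val).map J.restrict = (ν.map Subtype.val).map J.restrict := by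
    intro J
    rw [Measure.map_map (hres J) hval, Measure.map_map (hres J) hval]
    have hm := (hres J).comp hval
    refine Measure.ext_of_charFunDual (funext fun L => ?_)
    have hcont : Continuous fun v : J → EuclideanSpace ℝ (Fin d) =>
        Complex.exp ((L v : ℝ) * Complex.I) := by fun_prop
    set e : I → ℂ := fun z => Complex.exp ((L (J.restrict z.1) : ℝ) * Complex.I) with he
    have hem : Measurable e := hcont.measurable.comp hm
    have hen : ∀ z, ‖e z‖ ≤ 1 := fun z => (Complex.norm_exp_ofReal_mul_I _).le
    rw [charFunDual_apply, charFunDual_apply,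
      integral_map hm.aemeasurable hcont.aestronglyMeasurable,
      integral_map hm.aemeasurable hcont.aestronglyMeasurable]
    change ∫ z, e z ∂μ = ∫ z, e z ∂ν
    rw [integral_withDensity_eq_integral_toReal_smul₀ hg.1.aemeasurable.ennreal_ofReal
        (Eventually.of_forall fun _ => ENNReal.ofReal_lt_top),
      integral_withDensity_eq_integral_toReal_smul₀
        (f := fun z => ENNReal.ofReal (-g z)) hg.neg.1.aemeasurable.ennreal_ofReal
        (Eventually.of_forall fun _ => ENNReal.ofReal_lt_top), ← sub_eq_zero, ← integral_sub]
    · rw [← h J L]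
      congr 1 with z
      rw [← sub_smul, ← Complex.coe_smul, smul_eq_mul]
      congr 2
      rw [ENNReal.toReal_ofReal', ENNReal.toReal_ofReal', max_comm, max_comm (-g z)]
      rcases le_total 0 (g z) with h0 | h0
      · simp [h0]
      · simp [h0]
    · refine Integrable.smul_of_top_left ?_ (memLp_top_of_bound hem.aestronglyMeasurable 1
        (Eventually.of_forall hen))
      simpa [ENNReal.toReal_ofReal'] using hg.pos_part.ofReal (𝕜 := ℂ)
    · refine Integrable.smul_of_top_left ?_ (memLp_top_of_bound hem.aestronglyMeasurable 1
        (Eventually.of_forall hen))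
      simpa [ENNReal.toReal_ofReal'] using hg.neg_part.ofReal (𝕜 := ℂ)
  have hmap : μ.map Subtype.val = ν.map Subtype.val :=
    IsProjectiveLimit.unique (P := fun J => (ν.map Subtype.val).map J.restrict) hmarg fun _ => rfl
  have hμν : μ = ν := by
    ext s hs
    -- In the trace `σ`-algebra every measurable set is such a preimage, so equality of the
    -- push-forwards suffices.
    obtain ⟨t, ht, rfl⟩ := hs
    rw [← Measure.map_apply hval ht, hmap, Measure.map_apply hval ht]
  refine hg.ae_eq_zero_of_forall_setIntegral_eq_zero fun s hs _ => ?_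
  rw [integral_eq_lintegral_pos_part_sub_lintegral_neg_part hg.integrableOn,
    ← withDensity_apply _ hs, ← withDensity_apply _ hs, sub_eq_zero]
  change (μ s).toReal = (ν s).toReal
  rw [hμν]

end Uniqueness

/-! ### The delay line as a linear reservoir on `ℓ^q`. -/

section Reservoir

/-- The time `t - k`. -/
def ZMinus.back (t : ZMinus) (k : ℕ) : ZMinus := ⟨t.1 - k, by have := t.2; omega⟩

@[simp] lemma ZMinus.back_zero (t : ZMinus) : t.back 0 = t := Subtype.ext (by simp [ZMinus.back])

lemma ZMinus.pred_back (t : ZMinus) (k : ℕ) : t.pred.back k = t.back (k + 1) :=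
  Subtype.ext (by simp only [ZMinus.back, ZMinus.pred]; push_cast; ring)

variable {d : ℕ} {q : ℝ≥0∞}

/-- The state of the delay line at time `t`: its coordinate with index `Nat.pair k j` is
`2⁻ᵏ` times the `j`-th coordinate of `z_{t-k}`. -/
noncomputable def delayCoord (z : InputSeq d) (t : ZMinus) (i : ℕ) : ℝ :=
  if h : i.unpair.2 < d then (1 / 2) ^ i.unpair.1 * z (t.back i.unpair.1) ⟨i.unpair.2, h⟩ else 0

/-- A summable sequence dominating the delay line of inputs bounded by one. -/
noncomputable def delayEnvelope (d i : ℕ) : ℝ :=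
  if i.unpair.2 < d then (1 / 2) ^ i.unpair.1 else 0

lemma summable_delayEnvelope (d : ℕ) : Summable (delayEnvelope d) := by
  rw [← Nat.pairEquiv.summable_iff]
  have h1 : Summable fun k : ℕ => (1 / 2 : ℝ) ^ k := summable_geometric_two
  have h2 : Summable fun j : ℕ => if j < d then (1 : ℝ) else 0 :=
    summable_of_hasFiniteSupport ((Set.finite_lt_nat d).subset fun j hj => by
      by_contra hcon
      exact hj (if_neg hcon))
  refine (h1.mul_of_nonneg h2 (fun _ => by positivity)
    (fun j => by change 0 ≤ ite _ _ _; split_ifs <;> simp)).congr fun x => ?_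
  change _ = delayEnvelope d (Nat.pair x.1 x.2)
  simp [delayEnvelope]

lemma memℓp_delayEnvelope (hq : 1 ≤ q) (d : ℕ) : Memℓp (delayEnvelope d) q := by
  refine Memℓp.of_exponent_ge (q := 1) (memℓp_gen ?_) hq
  simpa using (summable_delayEnvelope d).abs

lemma abs_coord_le_norm (v : EuclideanSpace ℝ (Fin d)) (j : Fin d) : |v j| ≤ ‖v‖ := by
  simpa using PiLp.norm_apply_le v j

lemma abs_delayCoord_le {z : InputSeq d} {M : ℝ} (hM : ∀ t, ‖z t‖ ≤ M) (t : ZMinus) (i : ℕ) :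
    |delayCoord z t i| ≤ M * delayEnvelope d i := by
  unfold delayCoord delayEnvelope
  split_ifs with h
  · rw [abs_mul, abs_of_nonneg (by positivity), mul_comm]
    gcongr
    exact (abs_coord_le_norm _ _).trans (hM _)
  · simp

/-- The index of the next coordinate of the delay line. -/
def delayIndex (i : ℕ) : ℕ := Nat.pair (i.unpair.1 + 1) i.unpair.2

lemma delayIndex_injective : Function.Injective delayIndex := by
  intro i j h
  have h' := congrArg Nat.unpair h
  simp only [delayIndex, Nat.unpair_pair, Prod.mk.injEq, add_left_inj] at h'
  rw [← Nat.pair_unpair i, ← Nat.pair_unpair j, h'.1, h'.2]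

/-- The transition of the delay line on sequences. -/
noncomputable def shiftCoord (x : ℕ → ℝ) (i : ℕ) : ℝ :=
  if i.unpair.1 = 0 then 0 else 1 / 2 * x (Nat.pair (i.unpair.1 - 1) i.unpair.2)

lemma shiftCoord_delayIndex (x : ℕ → ℝ) (i : ℕ) : shiftCoord x (delayIndex i) = 1 / 2 * x i := by
  simp [shiftCoord, delayIndex]

lemma shiftCoord_of_notMem (x : ℕ → ℝ) {i : ℕ} (hi : i ∉ Set.range delayIndex) :
    shiftCoord x i = 0 := by
  refine if_pos ?_
  by_contra h
  refine hi ⟨Nat.pair (i.unpair.1 - 1) i.unpair.2, ?_⟩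
  simp only [delayIndex, Nat.unpair_pair]
  rw [Nat.sub_add_cancel (Nat.one_le_iff_ne_zero.2 h), Nat.pair_unpair]

lemma abs_shiftCoord_le {x : ℕ → ℝ} {M : ℝ} (hM : ∀ i, |x i| ≤ M) (i : ℕ) :
    |shiftCoord x i| ≤ 1 / 2 * M := by
  have hM0 : 0 ≤ M := (abs_nonneg _).trans (hM 0)
  unfold shiftCoord
  split_ifs
  · simpa using hM0
  · rw [abs_mul, abs_of_nonneg (by norm_num : (0 : ℝ) ≤ 1 / 2)]
    gcongr
    exact hM _

/-- The shift moves `x / 2` along the injection `delayIndex` and is zero off its range. -/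
lemma memℓp_shiftCoord (hq : 1 ≤ q) {x : ℕ → ℝ} (hx : Memℓp x q) : Memℓp (shiftCoord x) q := by
  rcases q.trichotomy with rfl | rfl | hq'
  · simp at hq
  · obtain ⟨M, hM⟩ := memℓp_infty_iff.1 hx
    exact memℓp_infty ⟨1 / 2 * M, by
      rintro _ ⟨i, rfl⟩
      exact abs_shiftCoord_le (fun i => hM ⟨i, rfl⟩) i⟩
  · rw [memℓp_gen_iff hq'] at hx ⊢
    rw [← delayIndex_injective.summable_iff]
    · simp only [Function.comp_def, shiftCoord_delayIndex, norm_mul]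
      simp_rw [Real.mul_rpow (norm_nonneg _) (norm_nonneg _)]
      exact hx.mul_left _
    · intro i hi
      simp [shiftCoord_of_notMem x hi, Real.zero_rpow hq'.ne']

/-- The transition operator of the delay line. -/
noncomputable def delayShift (hq : 1 ≤ q) : SeqSpace q →ₗ[ℝ] SeqSpace q where
  toFun x := ⟨shiftCoord x, memℓp_shiftCoord hq (lp.memℓp x)⟩
  map_add' x y := by
    refine lp.ext (funext fun i => ?_)
    change shiftCoord _ i = shiftCoord _ i + shiftCoord _ i
    unfold shiftCoord
    split_ifs <;> simp [mul_add]
  map_smul' c x := by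
    refine lp.ext (funext fun i => ?_)
    change shiftCoord _ i = c * shiftCoord _ i
    unfold shiftCoord
    split_ifs
    · simp
    · simp only [lp.coeFn_smul, Pi.smul_apply, smul_eq_mul]; ring

/-- The input map of the delay line on sequences. -/
noncomputable def inputCoord (v : EuclideanSpace ℝ (Fin d)) (i : ℕ) : ℝ :=
  if h : i.unpair.2 < d then (if i.unpair.1 = 0 then v ⟨i.unpair.2, h⟩ else 0) else 0

lemma abs_inputCoord_le (v : EuclideanSpace ℝ (Fin d)) (i : ℕ) :
    |inputCoord v i| ≤ ‖v‖ * delayEnvelope d i := by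
  unfold inputCoord delayEnvelope
  split_ifs with h h0
  · simpa [h0] using abs_coord_le_norm _ _
  · simp
  · simp

/-- The input operator of the delay line. -/
noncomputable def delayInput (hq : 1 ≤ q) : EuclideanSpace ℝ (Fin d) →ₗ[ℝ] SeqSpace q where
  toFun v := ⟨inputCoord v, ((memℓp_delayEnvelope hq d).const_mul ‖v‖).mono (abs_inputCoord_le v)⟩
  map_add' v v' := by
    refine lp.ext (funext fun i => ?_)
    change inputCoord _ i = inputCoord _ i + inputCoord _ i
    unfold inputCoord
    split_ifs <;> simp
  map_smul' c v := by
    refine lp.ext (funext fun i => ?_)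
    change inputCoord _ i = c * inputCoord _ i
    unfold inputCoord
    split_ifs <;> simp

lemma delayCoord_eq (z : InputSeq d) (t : ZMinus) (i : ℕ) :
    delayCoord z t i = shiftCoord (delayCoord z t.pred) i + inputCoord (z t) i := by
  obtain ⟨k, j, rfl⟩ : ∃ k j, i = Nat.pair k j := ⟨_, _, (Nat.pair_unpair i).symm⟩
  simp only [delayCoord, shiftCoord, inputCoord, Nat.unpair_pair]
  by_cases h : j < d
  · cases k with
    | zero => simp [h]
    | succ k => simp [h, ZMinus.pred_back, pow_succ]; ring
  · simp [h]

/-- The delay line has a unique bounded solution for each bounded input, namely `delayCoord`. -/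
lemma delay_solution (hq : 1 ≤ q) {σ₁ : ℝ → ℝ} (hσ₁ : ∀ x, σ₁ x = x) {z : InputSeq d}
    (hz : BddAbove (Set.range fun t => ‖z t‖)) :
    (∃! x : ZMinus → SeqSpace q,
      IsBoundedSolution σ₁ (delayShift hq) (delayInput hq) 0 z x) ∧
    ∀ x : ZMinus → SeqSpace q, IsBoundedSolution σ₁ (delayShift hq) (delayInput hq) 0 z x →
      ∀ t i, x t i = delayCoord z t i := by
  have hq0 : q ≠ 0 := (zero_lt_one.trans_le hq).ne'
  obtain ⟨M, hM⟩ := hz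
  have hM : ∀ t, ‖z t‖ ≤ M := fun t => hM ⟨t, rfl⟩
  set env : SeqSpace q := ⟨fun i => M * delayEnvelope d i, (memℓp_delayEnvelope hq d).const_mul M⟩
  set x₀ : ZMinus → SeqSpace q := fun t => ⟨delayCoord z t,
    ((memℓp_delayEnvelope hq d).const_mul M).mono (abs_delayCoord_le hM t)⟩ with hx₀
  have sol : IsBoundedSolution σ₁ (delayShift hq) (delayInput hq) 0 z x₀ := by
    refine ⟨⟨‖env‖, ?_⟩, fun t i => ?_⟩
    · rintro _ ⟨t, rfl⟩
      exact lp.norm_mono hq0 fun i => (abs_delayCoord_le hM t i).trans (le_abs_self _)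
    · rw [hσ₁, add_zero]
      exact delayCoord_eq z t i
  have uniq : ∀ x : ZMinus → SeqSpace q,
      IsBoundedSolution σ₁ (delayShift hq) (delayInput hq) 0 z x → ∀ t i, x t i = x₀ t i := by
    rintro x ⟨⟨N, hN⟩, hx⟩ t i
    obtain ⟨⟨N₀, hN₀⟩, hx₀⟩ := sol
    -- The difference of two solutions solves the input-free equation, and each step back in time
    -- gains a factor `1 / 2` over a bound uniform in time.
    have hdec : ∀ (n : ℕ) (t : ZMinus) (i : ℕ), |x t i - x₀ t i| ≤ (1 / 2) ^ n * (N + N₀) := by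
      intro n
      induction n with
      | zero =>
        intro t i
        have h1 : |x t i| ≤ N := (lp.norm_apply_le_norm hq0 (x t) i).trans (hN ⟨t, rfl⟩)
        have h2 : |x₀ t i| ≤ N₀ := (lp.norm_apply_le_norm hq0 (x₀ t) i).trans (hN₀ ⟨t, rfl⟩)
        rw [pow_zero, one_mul]
        exact (abs_sub _ _).trans (add_le_add h1 h2)
      | succ n ih =>
        intro t i
        have e : x t i - x₀ t i = shiftCoord (fun i => x t.pred i - x₀ t.pred i) i := by
          rw [hx t i, hx₀ t i, hσ₁, hσ₁]
          change (shiftCoord _ i + inputCoord _ i + 0) - (shiftCoord _ i + inputCoord _ i + 0) = _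
          unfold shiftCoord
          split_ifs
          · simp
          · ring
        rw [e, pow_succ']
        exact (abs_shiftCoord_le (ih t.pred) i).trans_eq (by ring)
    have hlim : Filter.Tendsto (fun n : ℕ => (1 / 2 : ℝ) ^ n * (N + N₀)) Filter.atTop (nhds 0) := by
      simpa using (tendsto_pow_atTop_nhds_zero_of_lt_one (by norm_num : (0 : ℝ) ≤ 1 / 2)
        (by norm_num)).mul_const (N + N₀)
    have := ge_of_tendsto' hlim fun n => hdec n t i
    exact sub_eq_zero.1 (abs_eq_zero.1 (le_antisymm this (abs_nonneg _)))
  exact ⟨⟨x₀, sol, fun x hx => funext fun t => lp.ext (funext fun i => uniq x hx t i)⟩, uniq⟩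

end Reservoir

/-! ### Linear readouts and finite networks as Barron functionals. -/

section Readout

variable {d : ℕ} {p q : ℝ≥0∞}

/-- A finitely supported weight as an element of `ℓ^p`. -/
def finiteWeight (p : ℝ≥0∞) (α : ℕ →₀ ℝ) : SeqSpace p :=
  ⟨fun i => α i, (memℓp_zero (E := fun _ : ℕ => ℝ) (f := fun i => α i)
    α.hasFiniteSupport).of_exponent_ge zero_le⟩

lemma pairing_finiteWeight (α : ℕ →₀ ℝ) (x : SeqSpace q) :
    pairing (finiteWeight p α) x = Finsupp.linearCombination ℝ (x : ℕ → ℝ) α := by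
  rw [Finsupp.linearCombination_apply, Finsupp.sum, pairing, tsum_eq_sum (s := α.support)]
  · rfl
  · intro i hi
    have : (finiteWeight p α : ℕ → ℝ) i = 0 := Finsupp.notMem_support_iff.1 hi
    rw [this, zero_mul]

/-- The linear functional of the input read out from the delay line by a finitely supported state
weight and an input weight. -/
noncomputable def readout (d : ℕ) :
    ((ℕ →₀ ℝ) × EuclideanSpace ℝ (Fin d)) →ₗ[ℝ] (InputSeq d → ℝ) where
  toFun θ z := Finsupp.linearCombination ℝ (delayCoord z ZMinus.zero.pred) θ.1 +
    inner ℝ θ.2 (z ZMinus.zero)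
  map_add' θ θ' := by
    ext z
    simp only [Prod.fst_add, Prod.snd_add, map_add, inner_add_left, Pi.add_apply]
    ring
  map_smul' c θ := by
    ext z
    simp [inner_smul_left, mul_add]

lemma readout_apply (θ : (ℕ →₀ ℝ) × EuclideanSpace ℝ (Fin d)) (z : InputSeq d) :
    readout d θ z = Finsupp.linearCombination ℝ (delayCoord z ZMinus.zero.pred) θ.1 +
      inner ℝ θ.2 (z ZMinus.zero) := rfl

lemma measurable_delayCoord (t : ZMinus) (i : ℕ) :
    Measurable fun z : InputSeq d => delayCoord z t i := by
  unfold delayCoord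
  split_ifs with h
  · fun_prop
  · fun_prop

lemma measurable_readout (θ : (ℕ →₀ ℝ) × EuclideanSpace ℝ (Fin d)) : Measurable (readout d θ) := by
  change Measurable fun z => Finsupp.linearCombination ℝ (delayCoord z ZMinus.zero.pred) θ.1 +
    inner ℝ θ.2 (z ZMinus.zero)
  simp only [Finsupp.linearCombination_apply, Finsupp.sum, smul_eq_mul]
  refine Measurable.add ?_ (by fun_prop)
  exact Finset.measurable_sum _ fun i _ => (measurable_delayCoord _ i).const_mul _

/-- Every coordinate of the input can be read out. -/
lemma coord_mem_range_readout (t : ZMinus) (j : Fin d) :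
    (fun z : InputSeq d => z t j) ∈ LinearMap.range (readout d) := by
  obtain ⟨t, ht⟩ := t
  rcases eq_or_lt_of_le ht with rfl | hlt
  · refine ⟨(0, EuclideanSpace.single j 1), ?_⟩
    ext z
    simp [readout_apply, ZMinus.zero, EuclideanSpace.inner_single_left]
  -- The state is read at time `-1`, so `z_t` sits in slot `-1 - t`; the power of two undoes its
  -- damping.
  · refine ⟨(Finsupp.single (Nat.pair (-1 - t).toNat j) (2 ^ (-1 - t).toNat), 0), ?_⟩
    ext z
    have hback : ZMinus.zero.pred.back (-1 - t).toNat = ⟨t, ht⟩ :=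
      Subtype.ext (by simp only [ZMinus.back, ZMinus.pred, ZMinus.zero]; omega)
    simp [readout_apply, delayCoord, hback]

/-- Every continuous linear functional of finitely many inputs can be read out. -/
lemma dual_mem_range_readout (J : Finset ZMinus)
    (L : StrongDual ℝ (J → EuclideanSpace ℝ (Fin d))) :
    (fun z : InputSeq d => L (J.restrict z)) ∈ LinearMap.range (readout d) := by
  have e : (fun z : InputSeq d => L (J.restrict z)) =
      ∑ t : J, ∑ j : Fin d, L (Pi.single t (EuclideanSpace.single j 1)) •
        fun z : InputSeq d => z t j := by
    ext z
    simp only [Finset.sum_apply, Pi.smul_apply, smul_eq_mul]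
    conv_lhs => rw [← Finset.univ_sum_single (J.restrict z), map_sum]
    refine Finset.sum_congr rfl fun t _ => ?_
    have hv : z t = ∑ j, z t j • EuclideanSpace.single j (1 : ℝ) := by
      ext i
      simp [Finset.sum_apply, Pi.single_apply]
    have := congrArg (fun v => L (Pi.single t v)) hv
    have hlin : ∀ v, L (Pi.single t v) =
        (L.toLinearMap ∘ₗ LinearMap.single ℝ (fun _ : J => EuclideanSpace ℝ (Fin d)) t) v :=
      fun v => rfl
    simp only [hlin, map_sum, map_smul, smul_eq_mul] at this ⊢
    rw [Finset.restrict_def]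
    refine this.trans (Finset.sum_congr rfl fun j _ => mul_comm _ _)
  rw [e]
  exact Submodule.sum_mem _ fun t _ => Submodule.sum_mem _ fun j _ =>
    Submodule.smul_mem _ _ (coord_mem_range_readout _ j)

/-- The neuron with activation `σ`, acting on the delay line. -/
noncomputable def neuron (σ : ℝ → ℝ) (I : Set (InputSeq d))
    (θ : ((ℕ →₀ ℝ) × EuclideanSpace ℝ (Fin d)) × ℝ) (z : I) : ℝ :=
  σ (readout d θ.1 z.1 + θ.2)

/-- Makes singletons Borel, so that every real function is integrable against a Dirac measure. -/
instance instT2SpaceParamSpace [Fact (1 ≤ p)] : T2Space (ParamSpace p d) :=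
  inferInstanceAs (T2Space (ℝ × SeqSpace p × EuclideanSpace ℝ (Fin d) × ℝ))

/-- Finite linear combinations of neurons are recurrent Barron functionals. -/
lemma mem_barronClass_of_mem_span [Fact (1 ≤ p)] (hq : 1 ≤ q) {σ₁ σ₂ : ℝ → ℝ}
    (hσ₁ : ∀ x, σ₁ x = x) {I : Set (InputSeq d)}
    (hI : ∀ z ∈ I, BddAbove (Set.range fun t => ‖z t‖)) {H : I → ℝ}
    (hH : H ∈ Submodule.span ℝ (Set.range (neuron σ₂ I))) :
    H ∈ barronClass p q σ₁ σ₂ I := by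
  obtain ⟨c, rfl⟩ := Finsupp.mem_span_range_iff_exists_finsupp.1 hH
  set s := c.support
  -- The extra atom `P₀` has output weight zero and keeps the mixture a probability measure even for
  -- empty `s`; the factor `n` in `P` cancels the mass `1 / n` of each atom.
  set n : ℝ := (s.card : ℝ) + 1 with hn
  have hn0 : 0 < n := by positivity
  set P : ((ℕ →₀ ℝ) × EuclideanSpace ℝ (Fin d)) × ℝ → ParamSpace p d :=
    fun θ => (n * c θ, finiteWeight p θ.1.1, θ.1.2, θ.2) with hP
  set P₀ : ParamSpace p d := (0, 0, 0, 0) with hP₀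
  set μ : Measure (ParamSpace p d) :=
    ENNReal.ofReal n⁻¹ • (∑ θ ∈ s, Measure.dirac (P θ) + Measure.dirac P₀) with hμ
  have hint : ∀ f : ParamSpace p d → ℝ, Integrable f μ := fun f => by
    refine Integrable.smul_measure (integrable_add_measure.2
      ⟨integrable_finsetSum_measure.2 fun θ _ => integrable_dirac (by simp),
        integrable_dirac (by simp)⟩) ENNReal.ofReal_ne_top
  have hintegral : ∀ f : ParamSpace p d → ℝ, ∫ θ, f θ ∂μ = n⁻¹ * (∑ θ ∈ s, f (P θ) + f P₀) := by
    intro f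
    rw [integral_smul_measure, integral_add_measure
      (integrable_finsetSum_measure.2 fun θ _ => integrable_dirac (by simp))
        (integrable_dirac (by simp)),
      integral_finsetSum_measure fun θ _ => integrable_dirac (by simp),
      ENNReal.toReal_ofReal (by positivity)]
    simp
  refine ⟨μ, 0, delayShift hq, delayInput hq, ⟨?_⟩, fun z => (delay_solution hq hσ₁ (hI z z.2)).1,
    ?_, fun z x hx => ⟨hint _, ?_⟩⟩
  · have hcard : (s.card : ℝ≥0∞) + 1 = ENNReal.ofReal n := by
      rw [hn, ENNReal.ofReal_add (by positivity) zero_le_one]; simp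
    simp only [hμ, Measure.smul_apply, Measure.add_apply, Measure.finsetSum_apply, measure_univ,
      Finset.sum_const, nsmul_eq_mul, mul_one, smul_eq_mul, hcard]
    rw [← ENNReal.ofReal_mul (by positivity), inv_mul_cancel₀ hn0.ne', ENNReal.ofReal_one]
  · exact ((hasFiniteIntegral_iff_ofReal (Filter.Eventually.of_forall fun θ =>
      mul_nonneg (abs_nonneg _) (by positivity))).1 (hint _).2)
  · have hx' : (x ZMinus.zero.pred : ℕ → ℝ) = delayCoord z.1 ZMinus.zero.pred :=
      funext fun i => (delay_solution hq hσ₁ (hI z z.2)).2 x hx _ i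
    rw [hintegral]
    simp only [hP, hP₀, ParamSpace.w, ParamSpace.a, ParamSpace.c, ParamSpace.b, zero_mul, add_zero,
      pairing_finiteWeight, hx', ← readout_apply]
    rw [Finsupp.sum, Finset.sum_apply, Finset.mul_sum]
    refine Finset.sum_congr rfl fun θ _ => ?_
    simp only [Pi.smul_apply, smul_eq_mul, neuron, ← mul_assoc, inv_mul_cancel₀ hn0.ne', one_mul]

end Readout

/-! ### Density of finite networks. -/

section Density

variable {d : ℕ} {r : ℝ≥0∞}

/-- The elements of `L^r` represented by finite linear combinations of neurons. -/
def neuronSubmodule (σ : ℝ → ℝ) {I : Set (InputSeq d)} (γ : Measure I) (r : ℝ≥0∞) :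
    Submodule ℝ (Lp ℝ r γ) where
  carrier := {f | ∃ H ∈ Submodule.span ℝ (Set.range (neuron σ I)),
    ∃ hH : MemLp H r γ, hH.toLp H = f}
  zero_mem' := ⟨0, zero_mem _, MemLp.zero, rfl⟩
  add_mem' := by
    rintro _ _ ⟨H, hH, hm, rfl⟩ ⟨H', hH', hm', rfl⟩
    exact ⟨H + H', add_mem hH hH', hm.add hm', rfl⟩
  smul_mem' := by
    rintro c _ ⟨H, hH, hm, rfl⟩
    exact ⟨c • H, Submodule.smul_mem _ c hH, hm.const_smul c, rfl⟩

/-- Finite linear combinations of `σ`-neurons are dense in `L^r` as soon as they contain all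
neurons of some bounded continuous non-constant activation `τ`. -/
lemma dense_neuronSubmodule {σ τ : ℝ → ℝ} (hτ : Continuous τ) {M : ℝ} (hM : ∀ x, |τ x| ≤ M)
    (hne : ∃ x y, τ x ≠ τ y) {I : Set (InputSeq d)}
    (hspan : ∀ θ, neuron τ I θ ∈ Submodule.span ℝ (Set.range (neuron σ I)))
    (γ : Measure I) [IsFiniteMeasure γ] [Fact (1 ≤ r)] (hr : r ≠ ∞) :
    Dense (neuronSubmodule σ γ r : Set (Lp ℝ r γ)) := by
  refine dense_of_forall_density hr _ fun g hg hann => ?_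
  obtain ⟨S, cS, iS, hS, hkill⟩ := exists_integrable_profile hτ hM hne
  refine ae_eq_zero_of_integral_exp_eq_zero hg fun J L => ?_
  obtain ⟨θ, hθ⟩ := dual_mem_range_readout J L
  have hmeas : ∀ θ, Measurable fun z : I => readout d θ z.1 :=
    fun θ => (measurable_readout θ).comp measurable_subtype_coe
  -- Readouts form a vector space, so dilating `θ` stays among the neurons. Testing with `τ` rather
  -- than `σ` keeps the test functions bounded, hence in `L^r`.
  have hA : Annihilates γ g (fun z : I => readout d θ z.1) τ := by
    intro s b
    have hm : Measurable (neuron τ I (s • θ, b)) :=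
      hτ.measurable.comp ((hmeas (s • θ)).add_const b)
    have hb : ∀ z, |neuron τ I (s • θ, b) z| ≤ M := fun z => hM _
    have := hann _ (memLp_of_bounded hm hb) hm ⟨M, hb⟩ ⟨_, hspan _, _, rfl⟩
    simpa [neuron] using this
  have := (hkill hg (hmeas θ) hA).integral_exp_eq_zero hg (hmeas θ) cS iS hS
  simpa only [hθ] using this

/-- The hat function is a linear combination of ReLU neurons. -/
lemma neuron_hat_mem_span {σ : ℝ → ℝ} (I : Set (InputSeq d))
    (θ : ((ℕ →₀ ℝ) × EuclideanSpace ℝ (Fin d)) × ℝ) :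
    neuron (fun x => σ (x + 1) - 2 * σ x + σ (x - 1)) I θ ∈
      Submodule.span ℝ (Set.range (neuron σ I)) := by
  have e : neuron (fun x => σ (x + 1) - 2 * σ x + σ (x - 1)) I θ =
      neuron σ I (θ.1, θ.2 + 1) - (2 : ℝ) • neuron σ I θ + neuron σ I (θ.1, θ.2 - 1) := by
    ext z
    simp [neuron, add_assoc, add_sub_assoc]
  rw [e]
  exact add_mem (sub_mem (Submodule.subset_span ⟨_, rfl⟩)
    (Submodule.smul_mem _ _ (Submodule.subset_span ⟨_, rfl⟩))) (Submodule.subset_span ⟨_, rfl⟩)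

/-- The second difference of ReLU is a hat supported in `[-1, 1]` with peak `1`. It serves as the
bounded activation in the ReLU case, where single neurons may fail to lie in `L^r`. -/
lemma abs_hat_le_one (x : ℝ) : |max (x + 1) 0 - 2 * max x 0 + max (x - 1) 0| ≤ 1 := by
  rw [abs_le]
  constructor <;>
  rcases max_cases (x + 1) 0 with h | h <;> rcases max_cases x 0 with h' | h' <;>
  rcases max_cases (x - 1) 0 with h'' | h'' <;> linarith

end Density

end RecurrentBarron

theorem proposition2p9
    (p q : ℝ≥0∞) [Fact (1 ≤ p)] (hpq : p.HolderConjugate q)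
    (σ₁ σ₂ : ℝ → ℝ) (hσ₁ : ∀ x, σ₁ x = x)
    (hσ₂ : (∀ x, σ₂ x = max x 0) ∨
      ((∃ M, ∀ x, |σ₂ x| ≤ M) ∧ Continuous σ₂ ∧ ∃ x y, σ₂ x ≠ σ₂ y))
    (d : ℕ) (D : Set (EuclideanSpace ℝ (Fin d)))
    (I : Set (RecurrentBarron.InputSeq d)) (hI : I ⊆ RecurrentBarron.boundedInputs D)
    (γ : Measure I) [IsProbabilityMeasure γ]
    (pbar : ℝ≥0∞) [Fact (1 ≤ pbar)] (hpbar : pbar ≠ ∞) :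
    Dense {f : Lp ℝ pbar γ | ∃ H ∈ RecurrentBarron.barronClass p q σ₁ σ₂ I,
      ∃ hH : MemLp H pbar γ, hH.toLp H = f} := by
  have hq : 1 ≤ q := hpq.symm.one_le
  have hdense : Dense (RecurrentBarron.neuronSubmodule σ₂ γ pbar : Set (Lp ℝ pbar γ)) := by
    rcases hσ₂ with hrelu | ⟨⟨M, hM⟩, hcont, hne⟩
    · obtain rfl : σ₂ = fun x => max x 0 := funext hrelu
      exact RecurrentBarron.dense_neuronSubmodule (by fun_prop) RecurrentBarron.abs_hat_le_one
        ⟨0, 1, by norm_num⟩ (RecurrentBarron.neuron_hat_mem_span I) γ hpbar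
    · exact RecurrentBarron.dense_neuronSubmodule hcont hM hne
        (fun θ => Submodule.subset_span ⟨θ, rfl⟩) γ hpbar
  refine hdense.mono ?_
  rintro f ⟨H, hH, hm, rfl⟩
  exact ⟨H, RecurrentBarron.mem_barronClass_of_mem_span hq hσ₁ (fun z hz => (hI hz).2) hH, hm, rfl⟩
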